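/- For $n\ge 8$, let $H_{n,7,3}$ be the $n$-vertex graph whose vertex set is partitioned into sets $A,B,C$ with $|A|=3$, $|B|=n-4$, $|C|=1$, and whose edges are all pairs with one vertex in $A$ and the other in $B$, together with all pairs of distinct vertices in $A\cup C$ (so $H_{n,7,3}$ is obtained from $K_n$ by deleting all edges inside a set of $n-3$ vertices). Let $e(G)$ denote the number of edges of $G$. Then for every integer $n\ge 8$ the following hold. (1) If $G$ is a $2$-connected simple graph on $n$ vertices that contains no cycle of length at least $7$, and $e(G)\ge\lfloor (5n-6)/2\rfloor$, then $G$ is (isomorphic to) a subgraph of $H_{n,7,3}$. (2) The bound on the number of edges is best possible: there is a $2$-connected simple graph $G$ on $n$ vertices, containing no cycle of length at least $7$, with $e(G)=\lfloor (5n-6)/2\rfloor-1$, that is not (isomorphic to) a subgraph of $H_{n,7,3}$. -/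

import Mathlib

/-- A finite graph is `k`-connected if it has more than `k` vertices and it stays connected
whenever fewer than `k` vertices are deleted. -/
def SimpleGraph.IsVertexConnected {V : Type*} [Fintype V] (G : SimpleGraph V) (k : ℕ) : Prop :=
  k < Fintype.card V ∧
    ∀ S : Finset V, S.card < k → (G.induce ((S : Set V)ᶜ)).Connected

/-- `G` has no cycle of length at least `k`, that is, its circumference is less than `k`. -/
def SimpleGraph.CircumferenceLT {V : Type*} (G : SimpleGraph V) (k : ℕ) : Prop :=
  ∀ (v : V) (p : G.Walk v v), p.IsCycle → p.length < k

/-- The graph `H_{n,k,a}` (for `n ≥ k` and `k / 2 > a ≥ 1`). Its vertex set `{0, …, n - 1}` is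
partitioned into `A = {i | i < a}`, `C = {i | a ≤ i < k - a}` and `B = {i | k - a ≤ i}`, of sizes
`a`, `k - 2 a` and `n - k + a`. The edges are all pairs between `A` and `B`, and all pairs of
distinct vertices in `A ∪ C`. -/
def kopylovGraph (n k a : ℕ) : SimpleGraph (Fin n) where
  Adj i j := i ≠ j ∧
    (((i : ℕ) < a ∧ k - a ≤ (j : ℕ)) ∨ (k - a ≤ (i : ℕ) ∧ (j : ℕ) < a) ∨
      ((i : ℕ) < k - a ∧ (j : ℕ) < k - a))
  symm := ⟨fun i j h => ⟨h.1.symm, by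
    rcases h.2 with h | h | h
    · exact Or.inr (Or.inl ⟨h.2, h.1⟩)
    · exact Or.inl ⟨h.2, h.1⟩
    · exact Or.inr (Or.inr ⟨h.2, h.1⟩)⟩⟩
  loopless := ⟨fun _ h => h.1 rfl⟩

/-!
Two observations reduce the theorem to an alternative between covers and edges. The graph
`H_{n,7,3}` has all edges that meet a set of three vertices, so a graph on `n` vertices is contained
in it if and only if three vertices cover all edges. And `e(G) ≥ ⌊(5 n - 6) / 2⌋` says that
`2 e(G) + 8 ≤ 5 n` fails. So the first part is `IsVertexConnected.exists_cover_or_ncard_edgeSet_le`: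
a `2`-connected graph with `n ≥ 8` and circumference at most `6` has a cover of size `3`, or
`2 e(G) + 8 ≤ 5 n`.

Let `C` be a longest cycle, with `c ≤ 6` vertices. By maximality, an ear of `C` (a path between two
of its vertices whose inner vertices are outside) has at most as many inner vertices as either arc
of `C` that it spans, hence at most `c / 2 - 1 ≤ 2` (`IsLongestCycleList.two_mul_ear_le`). Together
with `2`-connectedness this shows that every vertex outside is adjacent to `C`
(`IsVertexConnected.exists_adj_mem`) and that every edge leaving `C` extends to an ear with one or
two inner vertices (`IsVertexConnected.exists_ear`).

* A vertex outside has at most `c / 2` neighbours on `C`. If it has three, then `c = 6`, they are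
  every other vertex of `C`, and they cover all edges (`IsVertexConnected.cover_of_three_adj`).
* Otherwise, if there are no edges outside `C`, then each of the `n - c` vertices outside sends at
  most two edges to `C`. At most `2 c` edges join vertices of `C`: this is clear for `c ≤ 5`, and
  for `c = 6` any ear excludes three of the fifteen pairs
  (`IsLongestCycleList.sum_nbrCount_le_of_two_adj`). So `e(G) ≤ 2 n`, and `4 n + 8 ≤ 5 n`.
* Finally, if there is an edge outside `C`, then there is an ear with two inner vertices, so that
  `c = 6` and the ear joins opposite vertices of `C`, which excludes four of the fifteen pairs
  (`IsLongestCycleList.sum_nbrCount_le_of_long_ear`). The components outside are stars whose leaves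
  have only one neighbour on `C`, or have at most two vertices. So there are at most `5 / 2` edges
  per vertex outside (`sum_le_five_mul_card`), and `2 e(G) ≤ 2 * 11 + 5 (n - 6)`.

The bound is attained by `edgeJoinMatching n`, the join of an edge and a matching: a cycle meets the
matching in at most two paths, which have at most two vertices each, while four disjoint edges
have no cover of size three.
-/

/-! ### Cycles as vertex lists -/

namespace SimpleGraph

variable {V : Type*} {G : SimpleGraph V}

/-- The list `l` enumerates, in cyclic order, the vertices of a cycle of `G`. Unlike a closed walk,
the list does not repeat its first vertex, so its length is the length of the cycle. -/
structure IsCycleList (G : SimpleGraph V) (l : List V) : Prop where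
  nodup : l.Nodup
  three_le : 3 ≤ l.length
  chain : Cycle.Chain G.Adj (l : Cycle V)

/-- `l` enumerates a cycle of maximum length of `G`. -/
structure IsLongestCycleList (G : SimpleGraph V) (l : List V) : Prop where
  isCycleList : G.IsCycleList l
  length_le : ∀ l', G.IsCycleList l' → l'.length ≤ l.length

lemma IsCycleList.of_isRotated {l l' : List V} (h : G.IsCycleList l) (hr : l ~r l') :
    G.IsCycleList l' := by
  have hc : (l : Cycle V) = l' := Cycle.coe_eq_coe.2 hr
  exact ⟨hr.nodup_iff.1 h.nodup, hr.perm.length_eq ▸ h.three_le, hc ▸ h.chain⟩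

lemma IsLongestCycleList.of_isRotated {l l' : List V} (h : G.IsLongestCycleList l) (hr : l ~r l') :
    G.IsLongestCycleList l' :=
  ⟨h.1.of_isRotated hr, fun m hm => hr.perm.length_eq ▸ h.2 m hm⟩

/-- A cycle through `x` and `y` consists of two chains joining `x` and `y`. -/
lemma chain_cons_append_cons {x y : V} {A B : List V} :
    Cycle.Chain G.Adj ((x :: A ++ y :: B : List V) : Cycle V) ↔
      (x :: (A ++ [y])).IsChain G.Adj ∧ (y :: (B ++ [x])).IsChain G.Adj := by
  rw [List.cons_append, Cycle.chain_coe_cons, List.append_assoc, List.cons_append,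
    List.isChain_cons_split]

lemma isChain_reverse_link {x y : V} {P : List V} (h : (x :: (P ++ [y])).IsChain G.Adj) :
    (y :: (P.reverse ++ [x])).IsChain G.Adj := by
  have : (x :: (P ++ [y])).reverse.IsChain G.Adj := by
    rw [List.isChain_reverse]
    exact h.imp fun _ _ h => h.symm
  simpa using this

lemma IsCycleList.exists_isCycle {l : List V} (h : G.IsCycleList l) :
    ∃ (v : V) (p : G.Walk v v), p.IsCycle ∧ p.length = l.length := by
  obtain ⟨hnd, h3, hch⟩ := h
  match l, h3 with
  | a :: b :: t, h3 =>
    rw [Cycle.chain_coe_cons] at hch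
    have hab : G.Adj a b := hch.rel
    have hch' : (b :: (t ++ [a])).IsChain G.Adj := hch.of_cons
    set q := Walk.ofSupport _ (List.cons_ne_nil _ _) hch' with hq
    have hsup : q.support = b :: (t ++ [a]) := Walk.support_ofSupport _ _
    have hlen : q.length = t.length + 1 := (Walk.length_ofSupport _ _).trans (by simp)
    have hlast : (b :: (t ++ [a])).getLast (List.cons_ne_nil _ _) = a := by simp
    have hhead : (b :: (t ++ [a])).head (List.cons_ne_nil _ _) = b := by simp
    refine ⟨a, .cons hab (q.copy hhead hlast), ?_, by
      rw [Walk.length_cons, Walk.length_copy, hlen]; rfl⟩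
    have hpath : (q.copy hhead hlast).IsPath := by
      rw [Walk.isPath_def, Walk.support_copy, hsup]
      have : (b :: (t ++ [a])).Perm (a :: b :: t) := by
        have := List.perm_append_comm (l₁ := b :: t) (l₂ := [a])
        simpa using this
      exact this.nodup_iff.2 hnd
    rw [Walk.cons_isCycle_iff]
    refine ⟨hpath, fun hmem => ?_⟩
    have h1 := hpath.length_eq_one_of_mem_edges (Sym2.eq_swap ▸ hmem)
    simp only [Walk.length_copy, hlen, List.length_cons] at h1 h3
    omega

/-! ### Ears of a longest cycle -/

lemma IsLongestCycleList.length_le_of_ear {x y : V} {A B P : List V}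
    (h : G.IsLongestCycleList (x :: A ++ y :: B)) (hP : P.Nodup)
    (hd : ∀ v ∈ P, v ∉ x :: A ++ y :: B) (hc : (x :: (P ++ [y])).IsChain G.Adj) :
    P.length ≤ A.length := by
  rcases Nat.eq_zero_or_pos P.length with h0 | h0
  · omega
  by_contra! hlt
  have hn := h.1.nodup
  have h3 := h.1.three_le
  have := h.2 (x :: P ++ y :: B) ⟨by grind, by simp at h3 ⊢; omega,
    chain_cons_append_cons.2 ⟨hc, (chain_cons_append_cons.1 h.1.chain).2⟩⟩
  simp at this
  omega

/-- An ear of a longest cycle is not longer than either of the two arcs that it spans, hence at most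
as long as half of the cycle. -/
lemma IsLongestCycleList.two_mul_ear_le {l : List V} (h : G.IsLongestCycleList l) {x y : V}
    (hx : x ∈ l) (hy : y ∈ l) (hxy : x ≠ y) {P : List V} (hP : P.Nodup) (hd : ∀ v ∈ P, v ∉ l)
    (hc : (x :: (P ++ [y])).IsChain G.Adj) : 2 * P.length + 2 ≤ l.length := by
  obtain ⟨s, t, rfl⟩ := List.mem_iff_append.1 hx
  have hr : (s ++ x :: t) ~r (x :: t ++ s) := List.isRotated_append
  have h' := h.of_isRotated hr
  have hyts : y ∈ t ++ s := by
    have := hr.mem_iff.1 hy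
    simp only [List.cons_append, List.mem_cons] at this
    exact this.resolve_left hxy.symm
  obtain ⟨A, B, hAB⟩ := List.mem_iff_append.1 hyts
  have hr' : (s ++ x :: t) ~r (x :: A ++ y :: B) := by
    rw [List.cons_append, ← hAB]; exact hr
  have h1 := h.of_isRotated hr'
  have h2 := h1.of_isRotated (l' := y :: B ++ x :: A) List.isRotated_append
  have hA := h1.length_le_of_ear hP (fun v hv => by rw [← hr'.mem_iff]; exact hd v hv) hc
  have hB := h2.length_le_of_ear (P := P.reverse) (List.nodup_reverse.2 hP)
    (fun v hv => by
      rw [List.mem_reverse] at hv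
      have := hd v hv
      rw [hr'.mem_iff] at this
      grind) (isChain_reverse_link hc)
  rw [hr'.perm.length_eq]
  simp at hB ⊢
  omega

/-! ### Paths in graphs from which few vertices have been deleted -/

lemma exists_nodup_link (b : V) (W : List V) (a : V) (h : (a :: (W ++ [b])).IsChain G.Adj) :
    ∃ P : List V, P ⊆ W ∧ (a :: P).Nodup ∧ (a :: (P ++ [b])).IsChain G.Adj := by
  induction W generalizing a with
  | nil => exact ⟨[], by simp, by simp, h⟩
  | cons c W ih =>
    obtain ⟨P, hPW, hPn, hPc⟩ := ih c h.of_cons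
    by_cases ha : a ∈ c :: P
    · obtain ⟨s, t, hst⟩ := List.mem_iff_append.1 ha
      refine ⟨t, fun v hv => ?_, ?_, ?_⟩
      · have : v ∈ c :: P := by rw [hst]; simp [hv]
        grind
      · rw [hst] at hPn
        exact hPn.of_append_right
      · have : ((c :: P) ++ [b]).IsChain G.Adj := hPc
        rw [hst, List.append_assoc] at this
        exact this.right_of_append
    · exact ⟨c :: P, by grind, by simp_all, by
        simpa using ⟨h.rel, hPc⟩⟩

/-- A path that leaves `a`, avoids the deleted vertices `S`, and stops just before it first meets
the target `T`. -/
lemma exists_link_of_preconnected {S : Finset V}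
    (hS : (G.induce ((S : Set V)ᶜ)).Preconnected) {T : Set V} {a t : V} (haS : a ∉ S) (haT : a ∉ T)
    (htS : t ∉ S) (htT : t ∈ T) :
    ∃ (P : List V) (y : V), y ∈ T ∧ y ∉ S ∧ (a :: P).Nodup ∧ (∀ v ∈ a :: P, v ∉ T ∧ v ∉ S) ∧
      (a :: (P ++ [y])).IsChain G.Adj := by
  obtain ⟨p⟩ := hS ⟨a, by simpa using haS⟩ ⟨t, by simpa using htS⟩
  have key : ∀ (u w : ((S : Set V)ᶜ : Set V)), (G.induce ((S : Set V)ᶜ)).Walk u w → u.1 ∉ T →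
      w.1 ∈ T → ∃ (W : List V) (y : V), y ∈ T ∧ y ∉ S ∧ (∀ v ∈ u.1 :: W, v ∉ T ∧ v ∉ S) ∧
        (u.1 :: (W ++ [y])).IsChain G.Adj := by
    intro u w p
    induction p with
    | nil => intro h h'; exact absurd h' h
    | @cons u v w huv p ih =>
      intro hu hw
      have huS : u.1 ∉ S := fun h => u.2 (Finset.mem_coe.2 h)
      have hvS : v.1 ∉ S := fun h => v.2 (Finset.mem_coe.2 h)
      have huv' : G.Adj u.1 v.1 := huv
      by_cases hv : v.1 ∈ T
      · exact ⟨[], v.1, hv, hvS, by simp [hu, huS], by simpa using huv'⟩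
      · obtain ⟨W, y, hyT, hyS, hW, hc⟩ := ih hv hw
        exact ⟨v.1 :: W, y, hyT, hyS, by grind, by simpa using ⟨huv', hc⟩⟩
  obtain ⟨W, y, hyT, hyS, hW, hc⟩ := key _ _ p haT htT
  obtain ⟨P, hPW, hPn, hPc⟩ := exists_nodup_link y W a hc
  exact ⟨P, y, hyT, hyS, hPn, by grind, hPc⟩

end SimpleGraph

/-! ### The vertices outside a longest cycle of a `2`-connected graph -/

namespace SimpleGraph

variable {V : Type*} [Fintype V] {G : SimpleGraph V}

lemma IsVertexConnected.exists_link (hG : G.IsVertexConnected 2) {S : Finset V} (hS : S.card < 2)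
    {T : Set V} {a t : V} (haS : a ∉ S) (haT : a ∉ T) (htS : t ∉ S) (htT : t ∈ T) :
    ∃ (P : List V) (y : V), y ∈ T ∧ y ∉ S ∧ (a :: P).Nodup ∧ (∀ v ∈ a :: P, v ∉ T ∧ v ∉ S) ∧
      (a :: (P ++ [y])).IsChain G.Adj :=
  exists_link_of_preconnected (hG.2 S hS).preconnected haS haT htS htT

lemma IsVertexConnected.exists_isCycleList (hG : G.IsVertexConnected 2) :
    ∃ l, G.IsCycleList l := by
  classical
  -- A vertex with two neighbours `a` and `b`, and a path from `a` to `b` that avoids it.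
  have key : ∀ u a b : V, a ≠ b → G.Adj u a → G.Adj u b → ∃ l, G.IsCycleList l := by
    intro u a b hab hua hub
    obtain ⟨P, y, rfl, hyS, hP, hv, hc⟩ := hG.exists_link (S := {u}) (by simp) (T := {b})
      (a := a) (t := b) (by simpa using hua.ne') (by simpa using hab) (by simpa using hub.ne') rfl
    refine ⟨u :: (a :: P ++ [y]), ?_, by simp, ?_⟩
    · have := hub.ne
      simp at hv
      grind
    · rw [Cycle.chain_coe_cons]
      have : (u :: ((a :: P) ++ [y])).IsChain G.Adj := by simpa using ⟨hua, hc⟩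
      have h2 : ((u :: a :: P) ++ y :: [u]).IsChain G.Adj :=
        List.isChain_split.2 ⟨by simpa using this, by simpa using hub.symm⟩
      simpa using h2
  obtain ⟨x, y, z, hxy, hxz, hyz⟩ := Fintype.two_lt_card_iff.1 hG.1
  obtain ⟨P, t, ht, -, hP, hv, hc⟩ := hG.exists_link (S := ∅) (by simp) (T := {v | v ≠ x})
    (a := x) (t := y) (by simp) (by simp) (by simp) hxy.symm
  obtain ⟨w, hwx, hwt⟩ : ∃ w, w ≠ x ∧ w ≠ t := by
    by_cases h : y = t
    · exact ⟨z, hxz.symm, by rw [← h]; exact hyz.symm⟩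
    · exact ⟨y, hxy.symm, h⟩
  have hP0 : P = [] := by
    rcases P with _ | ⟨p, P⟩
    · rfl
    · have := hv p (by simp)
      simp at this hP
      exact absurd this.symm hP.1.1
  subst hP0
  have hxt : G.Adj x t := by simpa using hc
  obtain ⟨Q, s, hs, -, hQ, hvQ, hcQ⟩ := hG.exists_link (S := ∅) (by simp)
    (T := {v | v ≠ x ∧ v ≠ t}) (a := x) (t := w) (by simp) (by simp) (by simp) ⟨hwx, hwt⟩
  rcases Q with _ | ⟨q, Q⟩
  · exact key x t s hs.2.symm hxt (by simpa using hcQ)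
  · have hq : q = t := by
      have := hvQ q (by simp)
      simp at this hQ
      exact this fun h => hQ.1.1 h.symm
    subst hq
    have hQ0 : Q = [] := by
      rcases Q with _ | ⟨r, R⟩
      · rfl
      · have := hvQ r (by simp)
        simp at this hQ
        grind
    subst hQ0
    exact key q x s hs.1.symm hxt.symm (by simp at hcQ; exact hcQ.2)

/-- An edge that leaves a longest cycle of length at most `6` extends to an ear with at most two
inner vertices, and with two of them only if the cycle has length `6`. -/
lemma IsVertexConnected.exists_ear (hG : G.IsVertexConnected 2) {l : List V}
    (hl : G.IsLongestCycleList l) (hl6 : l.length ≤ 6) {d x : V} (hd : d ∉ l) (hx : x ∈ l)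
    (hdx : G.Adj d x) :
    ∃ y ∈ l, y ≠ x ∧ (G.Adj d y ∨ l.length = 6 ∧ ∃ e ∉ l, G.Adj d e ∧ G.Adj e y) := by
  obtain ⟨t, ht, htx⟩ : ∃ t ∈ l, t ≠ x := by
    have hn := hl.1.nodup
    match l, hl.1.three_le with
    | a :: b :: _, _ =>
      by_cases h : a = x
      · exact ⟨b, by simp, by grind⟩
      · exact ⟨a, by simp, h⟩
  obtain ⟨P, y, hy, -, hP, hv, hc⟩ := hG.exists_link (S := {x}) (by simp)
    (T := {v | v ∈ l ∧ v ≠ x}) (a := d) (t := t) (by simpa using hdx.ne) (by simp [hd])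
    (by simpa using htx) ⟨ht, htx⟩
  simp only [Set.mem_ofPred_eq, Finset.mem_singleton] at hy hv
  have hvl : ∀ v ∈ d :: P, v ∉ l := fun v h h' => (hv v h).1 ⟨h', (hv v h).2⟩
  have hlen := hl.two_mul_ear_le hx hy.1 hy.2.symm hP hvl (by simpa using ⟨hdx.symm, hc⟩)
  refine ⟨y, hy.1, hy.2, ?_⟩
  match P with
  | [] => exact Or.inl (by simpa using hc)
  | [e] =>
    simp at hc hlen
    exact Or.inr ⟨by omega, e, hvl e (by simp), hc.1, hc.2⟩
  | _ :: _ :: _ => simp at hlen; omega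

/-- Every vertex is on a longest cycle of length at most `6` or has a neighbour there. -/
lemma IsVertexConnected.exists_adj_mem (hG : G.IsVertexConnected 2) {l : List V}
    (hl : G.IsLongestCycleList l) (hl6 : l.length ≤ 6) {d : V} (hd : d ∉ l) :
    ∃ x ∈ l, G.Adj d x := by
  classical
  by_contra! hcon
  obtain ⟨c, hcl⟩ : ∃ c, c ∈ l := List.exists_mem_of_length_pos (by have := hl.1.three_le; omega)
  -- Along a path to the cycle there are consecutive vertices `d'`, `e` at distance `2` and `1`.
  obtain ⟨P, e, he, -, hP, hv, hc⟩ := hG.exists_link (S := ∅) (by simp)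
    (T := {v | v ∈ l ∨ ∃ x ∈ l, G.Adj v x}) (a := d) (t := c) (by simp)
    (by simp only [Set.mem_ofPred_eq]; push Not; exact ⟨hd, hcon⟩) (by simp) (Or.inl hcl)
  obtain ⟨d', hd', hde⟩ : ∃ d' ∈ d :: P, G.Adj d' e := by
    have hc' : ((d :: P) ++ [e]).IsChain G.Adj := hc
    rw [List.isChain_append] at hc'
    exact ⟨(d :: P).getLast (by simp), List.getLast_mem _,
      hc'.2.2 _ (List.getLast?_eq_getLast_of_ne_nil (by simp)) e (by simp)⟩
  have hd'T := (hv d' hd').1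
  simp only [Set.mem_ofPred_eq] at hd'T he
  push Not at hd'T
  obtain ⟨hd'l, hd'n⟩ := hd'T
  have hel : e ∉ l := fun h => hd'n e h hde
  obtain ⟨x, hx, hex⟩ := he.resolve_left hel
  clear hv hc hP hd' P hcon hd d
  -- Walks from `d'` to the cycle that avoid `e` end in `x`.
  have huniq : ∀ (W : List V) (y : V), (d' :: (W ++ [y])).IsChain G.Adj → y ∈ l →
      (∀ v ∈ d' :: W, v ∉ l ∧ v ≠ e) → y = x := by
    intro W y hW hy hWl
    by_contra hyx
    obtain ⟨Q, hQW, hQn, hQc⟩ := exists_nodup_link y W d' hW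
    have hQl : ∀ v ∈ d' :: Q, v ∉ l ∧ v ≠ e := by grind
    have := hl.two_mul_ear_le (P := e :: d' :: Q) hx hy (Ne.symm hyx) (by grind) (by grind)
      (by simpa using ⟨hex.symm, hde.symm, hQc⟩)
    rcases Q with _ | ⟨q, Q⟩
    · exact hd'n y hy (by simpa using hQc)
    · simp at this; omega
  obtain ⟨P, y, hy, -, hP, hv, hc⟩ := hG.exists_link (S := {e}) (by simp)
    (T := {v | v ∈ l}) (a := d') (t := c) (by simpa using hde.ne) hd'l
    (by simp; rintro rfl; exact hel hcl) hcl
  simp only [Set.mem_ofPred_eq, Finset.mem_singleton] at hy hv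
  obtain rfl := huniq P y hc hy hv
  -- So `d'` and `e` lie on a cycle through the single contact vertex, which a path from `e` to the
  -- rest of the longest cycle turns into a long ear.
  obtain ⟨t, ht, hty⟩ : ∃ t ∈ l, t ≠ y := by
    obtain ⟨t, ht, hty, -⟩ := hG.exists_ear hl hl6 hel hx hex
    exact ⟨t, ht, hty⟩
  obtain ⟨Q, z, hz, -, hQ, hvQ, hcQ⟩ := hG.exists_link (S := {y}) (by simp)
    (T := {v | v ∈ l ∧ v ≠ y}) (a := e) (t := t) (by simpa using hex.ne) (by simp [hel])
    (by simpa using hty) ⟨ht, hty⟩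
  simp only [Set.mem_ofPred_eq, Finset.mem_singleton] at hz hvQ
  have hQl : ∀ v ∈ e :: Q, v ∉ l := fun v h h' => (hvQ v h).1 ⟨h', (hvQ v h).2⟩
  have hdisj : ∀ v ∈ d' :: P, v ∉ Q := by
    intro v hvP hvQ'
    obtain ⟨s', t', rfl⟩ := List.mem_iff_append.1 hvQ'
    have h2 : (v :: (t' ++ [z])).IsChain G.Adj := by
      have h2 : ((e :: s') ++ (v :: (t' ++ [z]))).IsChain G.Adj := by simpa using hcQ
      exact h2.right_of_append
    refine hz.2 ?_
    rcases List.mem_cons.1 hvP with rfl | hvP'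
    · exact huniq t' z h2 hz.1 (by grind)
    · obtain ⟨s, t'', rfl⟩ := List.mem_iff_append.1 hvP'
      have h1 : ((d' :: s) ++ [v]).IsChain G.Adj := by
        have h1 : (((d' :: s) ++ [v]) ++ (t'' ++ [y])).IsChain G.Adj := by simpa using hc
        exact h1.left_of_append
      have h3 := List.isChain_split.2 ⟨h1, h2⟩
      exact huniq (s ++ v :: t') z (by simpa using h3) hz.1 (by grind)
  have hPy : (y :: (P.reverse ++ [d'])).IsChain G.Adj := isChain_reverse_link hc
  have hchain : (y :: ((P.reverse ++ d' :: e :: Q) ++ [z])).IsChain G.Adj := by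
    have : ((y :: P.reverse) ++ d' :: (e :: (Q ++ [z]))).IsChain G.Adj :=
      List.isChain_split.2 ⟨by simpa using hPy, by simpa using ⟨hde, hcQ⟩⟩
    simpa using this
  have := hl.two_mul_ear_le hx hz.1 hz.2.symm (P := P.reverse ++ d' :: e :: Q)
    (by grind) (by grind) hchain
  rcases P with _ | ⟨q, P⟩
  · exact hd'n y hx (by simpa using hc)
  · simp at this; omega

end SimpleGraph

/-! ### Longest cycles of length six -/

namespace SimpleGraph

variable {V : Type*} {G : SimpleGraph V}

/-- Two chains between `x` and `y` do not form a cycle that is longer than a longest one. -/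
lemma IsLongestCycleList.false_of_longer {l : List V} (hl : G.IsLongestCycleList l) {x y : V}
    {A B : List V} (hA : (x :: (A ++ [y])).IsChain G.Adj) (hAn : A.Nodup)
    (hBn : (x :: y :: B).Nodup) (hAB : ∀ v ∈ A, v ∉ x :: y :: B)
    (hlen : l.length < (x :: A ++ y :: B).length) (hB : (y :: (B ++ [x])).IsChain G.Adj) :
    False := by
  have := hl.1.three_le
  have hn : (x :: A ++ y :: B).Nodup := by
    have hp : (x :: A ++ y :: B).Perm (A ++ x :: y :: B) :=
      List.perm_middle.symm
    exact hp.nodup_iff.2 (List.nodup_append'.2 ⟨hAn, hBn, fun v h h' => hAB v h h'⟩)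
  exact absurd (hl.2 _ ⟨hn, by omega, chain_cons_append_cons.2 ⟨hA, hB⟩⟩) (by omega)

lemma IsLongestCycleList.not_adj_of_consecutive {x y : V} {B : List V}
    (hl : G.IsLongestCycleList (x :: y :: B)) {d : V} (hd : d ∉ x :: y :: B) (hx : G.Adj d x) :
    ¬ G.Adj d y := fun hy => by
  simpa using hl.length_le_of_ear (A := []) (P := [d]) (by simp) (by simpa using hd)
    (by simpa using ⟨hx.symm, hy⟩)

variable {v₀ v₁ v₂ v₃ v₄ v₅ : V}

lemma IsLongestCycleList.adj_hexagon (hl : G.IsLongestCycleList [v₀, v₁, v₂, v₃, v₄, v₅]) :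
    G.Adj v₀ v₁ ∧ G.Adj v₁ v₂ ∧ G.Adj v₂ v₃ ∧ G.Adj v₃ v₄ ∧ G.Adj v₄ v₅ ∧ G.Adj v₅ v₀ := by
  simpa [Cycle.chain_coe_cons] using hl.1.chain

/-- Suppose that some vertex outside a longest cycle of length six is adjacent to the three vertices
in even position. Then a vertex in odd position has no neighbour outside of the cycle. -/
lemma IsVertexConnected.not_adj_odd [Fintype V] (hG : G.IsVertexConnected 2)
    (hl : G.IsLongestCycleList [v₀, v₁, v₂, v₃, v₄, v₅]) {d e : V}
    (hd : d ∉ [v₀, v₁, v₂, v₃, v₄, v₅]) (he : e ∉ [v₀, v₁, v₂, v₃, v₄, v₅])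
    (h0 : G.Adj d v₀) (h2 : G.Adj d v₂) (h4 : G.Adj d v₄) : ¬ G.Adj e v₁ := by
  intro he1
  have hed : e ≠ d := by
    rintro rfl
    exact hl.not_adj_of_consecutive he h0 he1
  have hn := hl.1.nodup
  obtain ⟨a01, a12, a23, a34, a45, a50⟩ := hl.adj_hexagon
  have hda : ¬ G.Adj e d := fun h => hl.false_of_longer (x := v₁) (y := v₀) (A := [e, d])
    (B := [v₅, v₄, v₃, v₂]) (by simp; grind [adj_comm]) (by grind) (by grind) (by grind) (by simp)
    (by simp; grind [adj_comm])
  obtain ⟨P, y, hy, hy1, hn0, hPn, hP, hc⟩ : ∃ (P : List V) (y : V),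
      y ∈ [v₀, v₁, v₂, v₃, v₄, v₅] ∧ y ≠ v₁ ∧ 0 < P.length ∧ P.Nodup ∧
      (∀ v ∈ P, v ∉ [v₀, v₁, v₂, v₃, v₄, v₅] ∧ v ≠ d) ∧ (v₁ :: (P ++ [y])).IsChain G.Adj := by
    obtain ⟨y, hy, hy1, h | ⟨-, f, hf, hef, h⟩⟩ := hG.exists_ear hl (by simp) he (x := v₁)
      (by simp) he1
    · exact ⟨[e], y, hy, hy1, by simp, by simp, by simpa using ⟨by simpa using he, hed⟩,
        by simpa using ⟨he1.symm, h⟩⟩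
    · have hfd : f ≠ d := by rintro rfl; exact hda hef
      exact ⟨[e, f], y, hy, hy1, by simp, by simpa using hef.ne,
        by simpa using ⟨⟨by simpa using he, hed⟩, by simpa using hf, hfd⟩,
        by simpa using ⟨he1.symm, hef, h⟩⟩
  simp only [List.mem_cons, List.not_mem_nil, or_false] at hy
  rcases hy with rfl | rfl | rfl | rfl | rfl | rfl
  · exact hl.false_of_longer hc (B := [v₅, v₄, v₃, v₂]) hPn (by grind) (by grind)
      (by simpa using hn0) (by simp; grind [adj_comm])
  · exact hy1 rfl
  · exact hl.false_of_longer hc (B := [v₃, v₄, v₅, v₀]) hPn (by grind) (by grind)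
      (by simpa using hn0) (by simp; grind [adj_comm])
  · exact hl.false_of_longer hc (B := [v₄, v₅, v₀, d, v₂]) hPn (by grind) (by grind) (by simp)
      (by simp; grind [adj_comm])
  · exact hl.false_of_longer hc (B := [v₅, v₀, d, v₂]) hPn (by grind) (by grind)
      (by simpa using hn0) (by simp; grind [adj_comm])
  · exact hl.false_of_longer hc (B := [v₄, v₃, v₂, d, v₀]) hPn (by grind) (by grind) (by simp)
      (by simp; grind [adj_comm])

lemma IsLongestCycleList.not_adj_odd_odd (hl : G.IsLongestCycleList [v₀, v₁, v₂, v₃, v₄, v₅])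
    {d : V} (hd : d ∉ [v₀, v₁, v₂, v₃, v₄, v₅]) (h2 : G.Adj d v₂) (h4 : G.Adj d v₄) :
    ¬ G.Adj v₁ v₃ := by
  intro h
  have hn := hl.1.nodup
  obtain ⟨a01, a12, a23, a34, a45, a50⟩ := hl.adj_hexagon
  exact hl.false_of_longer (x := v₁) (y := v₃) (A := []) (B := [v₂, d, v₄, v₅, v₀])
    (by simpa using h) (by simp) (by grind) (by simp) (by simp) (by simp; grind [adj_comm])

/-- If a vertex outside a longest cycle of length six has three neighbours on this cycle, then these
three vertices cover all edges. -/
lemma IsVertexConnected.cover_of_three_adj [Fintype V] (hG : G.IsVertexConnected 2)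
    (hl : G.IsLongestCycleList [v₀, v₁, v₂, v₃, v₄, v₅]) {d : V}
    (hd : d ∉ [v₀, v₁, v₂, v₃, v₄, v₅]) (h0 : G.Adj d v₀) (h2 : G.Adj d v₂) (h4 : G.Adj d v₄)
    {u w : V} (huw : G.Adj u w) : u ∈ [v₀, v₂, v₄] ∨ w ∈ [v₀, v₂, v₄] := by
  have hr2 : [v₀, v₁, v₂, v₃, v₄, v₅] ~r [v₂, v₃, v₄, v₅, v₀, v₁] := ⟨2, rfl⟩
  have hr4 : [v₀, v₁, v₂, v₃, v₄, v₅] ~r [v₄, v₅, v₀, v₁, v₂, v₃] := ⟨4, rfl⟩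
  have hl2 := hl.of_isRotated hr2
  have hl4 := hl.of_isRotated hr4
  have hd2 := mt hr2.mem_iff.2 hd
  have hd4 := mt hr4.mem_iff.2 hd
  have hodd : ∀ e, e ∉ [v₀, v₁, v₂, v₃, v₄, v₅] → ∀ x ∈ [v₁, v₃, v₅], ¬ G.Adj e x := by
    intro e he x hx
    have h1 := hG.not_adj_odd hl hd he h0 h2 h4
    have h3 := hG.not_adj_odd hl2 hd2 (mt hr2.mem_iff.2 he) h2 h4 h0
    have h5 := hG.not_adj_odd hl4 hd4 (mt hr4.mem_iff.2 he) h4 h0 h2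
    simp only [List.mem_cons, List.not_mem_nil, or_false] at hx
    rcases hx with rfl | rfl | rfl <;> assumption
  have h13 := hl.not_adj_odd_odd hd h2 h4
  have h35 := hl2.not_adj_odd_odd hd2 h4 h0
  have h51 := hl4.not_adj_odd_odd hd4 h0 h2
  -- There are no ears with two inner vertices, as their ends would be two of the even vertices.
  have hear : ∀ e f x y, e ∉ [v₀, v₁, v₂, v₃, v₄, v₅] → f ∉ [v₀, v₁, v₂, v₃, v₄, v₅] →
      x ∈ [v₀, v₂, v₄] → y ∈ [v₀, v₂, v₄] → G.Adj e f → G.Adj x e → G.Adj f y → x = y := by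
    have hcore : ∀ x a y b c d e f, G.IsLongestCycleList [x, a, y, b, c, d] →
        e ∉ [x, a, y, b, c, d] → f ∉ [x, a, y, b, c, d] → G.Adj e f → G.Adj x e → ¬ G.Adj f y := by
      intro x a y b c d e f h he hf hef hxe hfy
      simpa using h.length_le_of_ear (A := [a]) (P := [e, f]) (by simpa using hef.ne)
        (by simpa using ⟨by simpa using he, by simpa using hf⟩) (by simpa using ⟨hxe, hef, hfy⟩)
    intro e f x y he hf hx hy hef hxe hfy
    have he2 := mt hr2.mem_iff.2 he
    have he4 := mt hr4.mem_iff.2 he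
    have hf2 := mt hr2.mem_iff.2 hf
    have hf4 := mt hr4.mem_iff.2 hf
    have k1 := hcore _ _ _ _ _ _ _ _ hl he hf hef
    have k2 := hcore _ _ _ _ _ _ _ _ hl2 he2 hf2 hef
    have k3 := hcore _ _ _ _ _ _ _ _ hl4 he4 hf4 hef
    have k4 := hcore _ _ _ _ _ _ _ _ hl hf he hef.symm
    have k5 := hcore _ _ _ _ _ _ _ _ hl2 hf2 he2 hef.symm
    have k6 := hcore _ _ _ _ _ _ _ _ hl4 hf4 he4 hef.symm
    simp only [List.mem_cons, List.not_mem_nil, or_false] at hx hy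
    grind [adj_comm]
  have hmem : ∀ e x, e ∉ [v₀, v₁, v₂, v₃, v₄, v₅] → x ∈ [v₀, v₁, v₂, v₃, v₄, v₅] → G.Adj e x →
      x ∈ [v₀, v₂, v₄] := by
    intro e x he hx hex
    have := hodd e he x
    simp only [List.mem_cons, List.not_mem_nil, or_false] at this hx ⊢
    tauto
  by_cases hu : u ∈ [v₀, v₁, v₂, v₃, v₄, v₅] <;> by_cases hw : w ∈ [v₀, v₁, v₂, v₃, v₄, v₅]
  · clear hear hmem hodd hd hd2 hd4
    simp only [List.mem_cons, List.not_mem_nil, or_false] at hu hw ⊢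
    have := huw.symm
    have := huw.ne
    by_contra! hcon
    obtain ⟨hu', hw'⟩ := hcon
    have hu1 : u = v₁ ∨ u = v₃ ∨ u = v₅ := by tauto
    have hw1 : w = v₁ ∨ w = v₃ ∨ w = v₅ := by tauto
    rcases hu1 with rfl | rfl | rfl <;> rcases hw1 with rfl | rfl | rfl <;> tauto
  · exact Or.inl (hmem w u hw hu huw.symm)
  · exact Or.inr (hmem u w hu hw huw)
  · exfalso
    obtain ⟨x, hx, hux⟩ := hG.exists_adj_mem hl (by simp) hu
    obtain ⟨z, hz, hwz⟩ := hG.exists_adj_mem hl (by simp) hw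
    have hx' := hmem u x hu hx hux
    have hz' := hmem w z hw hz hwz
    obtain ⟨y, hy, hyx, h | ⟨-, f, hf, huf, hfy⟩⟩ := hG.exists_ear hl (by simp) hu hx hux
    · have hy' := hmem u y hu hy h
      exact hyx ((hear u w y z hu hw hy' hz' huw h.symm hwz).trans
        (hear u w x z hu hw hx' hz' huw hux.symm hwz).symm)
    · exact hyx (hear u f x y hu hf hx' (hmem f y hf hy hfy) huf hux.symm hfy).symm

end SimpleGraph

/-! ### Counting edges -/

namespace SimpleGraph

variable {V : Type*} {G : SimpleGraph V}

open Classical in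
/-- The entry of the adjacency matrix of `G`, as a natural number. -/
noncomputable def adjInd (G : SimpleGraph V) (u v : V) : ℕ := if G.Adj u v then 1 else 0

lemma adjInd_comm (u v : V) : G.adjInd u v = G.adjInd v u := by
  by_cases h : G.Adj u v
  · simp [adjInd, h, h.symm]
  · simp [adjInd, h, mt Adj.symm h]

lemma adjInd_self (u : V) : G.adjInd u u = 0 := by simp [adjInd]

lemma adjInd_le_one (u v : V) : G.adjInd u v ≤ 1 := by unfold adjInd; split_ifs <;> simp

lemma adjInd_of_adj {u v : V} (h : G.Adj u v) : G.adjInd u v = 1 := by simp [adjInd, h]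

lemma adjInd_of_not_adj {u v : V} (h : ¬ G.Adj u v) : G.adjInd u v = 0 := by simp [adjInd, h]

lemma adjInd_eq_one {u v : V} : G.adjInd u v = 1 ↔ G.Adj u v := by simp [adjInd]

lemma adjInd_add_le_one {u v u' v' : V} (h : ¬ (G.Adj u v ∧ G.Adj u' v')) :
    G.adjInd u v + G.adjInd u' v' ≤ 1 := by
  unfold adjInd; split_ifs <;> simp_all

/-- The number of neighbours of `u` in `s`. -/
noncomputable def nbrCount (G : SimpleGraph V) (u : V) (s : Finset V) : ℕ := ∑ v ∈ s, G.adjInd u v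

lemma nbrCount_eq_zero {u : V} {s : Finset V} (h : ∀ v ∈ s, ¬ G.Adj u v) : G.nbrCount u s = 0 :=
  Finset.sum_eq_zero fun v hv => adjInd_of_not_adj (h v hv)

lemma exists_adj_of_nbrCount_pos {u : V} {s : Finset V} (h : 0 < G.nbrCount u s) :
    ∃ v ∈ s, G.Adj u v := by
  by_contra! hcon
  exact h.ne' (nbrCount_eq_zero hcon)

lemma nbrCount_le_one {u : V} {s : Finset V}
    (h : ∀ v ∈ s, ∀ w ∈ s, G.Adj u v → G.Adj u w → v = w) : G.nbrCount u s ≤ 1 := by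
  classical
  by_contra! hcon
  obtain ⟨v, hv, huv⟩ := exists_adj_of_nbrCount_pos (by omega : 0 < G.nbrCount u s)
  have h1 : G.nbrCount u s = G.adjInd u v :=
    Finset.sum_eq_single_of_mem v hv fun w hw hwv =>
      adjInd_of_not_adj fun huw => hwv (h w hw v hv huw huv)
  have := G.adjInd_le_one u v
  omega

lemma exists_two_adj_of_nbrCount {u : V} {s : Finset V} (h : 2 ≤ G.nbrCount u s) :
    ∃ v ∈ s, ∃ w ∈ s, v ≠ w ∧ G.Adj u v ∧ G.Adj u w := by
  by_contra! hcon
  have := nbrCount_le_one (G := G) (u := u) (s := s)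
    fun v hv w hw huv huw => by_contra fun hvw => hcon v hv w hw hvw huv huw
  omega

lemma nbrCount_lt_card {u : V} {s : Finset V} (hu : u ∈ s) : G.nbrCount u s < s.card := by
  rw [Finset.card_eq_sum_ones]
  exact Finset.sum_lt_sum (fun v _ => adjInd_le_one u v) ⟨u, hu, by simp [adjInd_self]⟩

lemma nbrCount_toFinset [DecidableEq V] {l : List V} (h : l.Nodup) (u : V) :
    G.nbrCount u l.toFinset = (l.map (G.adjInd u)).sum :=
  List.sum_toFinset _ h

/-- The edges are counted according to whether they lie inside `C` or meet its complement. -/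
lemma two_mul_ncard_edgeSet [Fintype V] [DecidableEq V] (C : Finset V) :
    2 * G.edgeSet.ncard = ∑ u ∈ C, G.nbrCount u C +
      ∑ d ∈ Cᶜ, (2 * G.nbrCount d C + G.nbrCount d Cᶜ) := by
  classical
  have h1 : 2 * G.edgeSet.ncard = ∑ u, ∑ v, G.adjInd u v := by
    rw [← coe_edgeFinset, Set.ncard_coe_finset, ← sum_degrees_eq_twice_card_edges]
    refine Finset.sum_congr rfl fun u _ => ?_
    simp [adjInd, ← card_neighborFinset_eq_degree, neighborFinset_eq_filter]
  have h2 : ∑ u ∈ C, G.nbrCount u Cᶜ = ∑ d ∈ Cᶜ, G.nbrCount d C := by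
    unfold nbrCount
    rw [Finset.sum_comm]
    exact Finset.sum_congr rfl fun u _ => Finset.sum_congr rfl fun v _ => adjInd_comm _ _
  have h3 : ∀ u, ∑ v, G.adjInd u v = G.nbrCount u C + G.nbrCount u Cᶜ := fun u =>
    (Finset.sum_add_sum_compl C _).symm
  rw [h1, ← Finset.sum_add_sum_compl C]
  simp_rw [h3]
  simp only [Finset.sum_add_distrib, ← Finset.mul_sum]
  omega

/-- Suppose that every vertex of `R` has at most two neighbours in `C`, and that the neighbours in
`R` of a vertex with several of them are leaves of `G[R]` with at most one neighbour in `C`. So the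
components of `G[R]` are stars, and there are on average at most `5 / 2` edges per vertex of `R`. -/
lemma sum_le_five_mul_card {C R : Finset V} (h2 : ∀ d ∈ R, G.nbrCount d C ≤ 2)
    (hstar : ∀ d ∈ R, 2 ≤ G.nbrCount d R → ∀ e ∈ R, G.Adj d e →
      G.nbrCount e C ≤ 1 ∧ G.nbrCount e R ≤ 1) :
    ∑ d ∈ R, (2 * G.nbrCount d C + G.nbrCount d R) ≤ 5 * R.card := by
  classical
  -- An edge of `G[R]` is charged with total weight `2` to its ends: to the leaf if the other end is
  -- the centre of a star with several leaves, and evenly otherwise.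
  let w : V → V → ℕ := fun d e =>
    if 2 ≤ G.nbrCount d R then 0 else if 2 ≤ G.nbrCount e R then 2 else 1
  have hw : ∀ d ∈ R, ∀ e ∈ R, G.adjInd d e * (w d e + w e d) = 2 * G.adjInd d e := by
    intro d hd e he
    by_cases hde : G.Adj d e
    · have : w d e + w e d = 2 := by
        by_cases h : 2 ≤ G.nbrCount d R
        · have := (hstar d hd h e he hde).2
          simp only [w]
          split_ifs <;> omega
        · simp only [w]
          split_ifs <;> omega
      rw [this, mul_comm]
    · simp [adjInd_of_not_adj hde]
  have hsum : ∑ d ∈ R, G.nbrCount d R = ∑ d ∈ R, ∑ e ∈ R, G.adjInd d e * w d e := by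
    have h1 : 2 * ∑ d ∈ R, G.nbrCount d R =
        ∑ d ∈ R, ∑ e ∈ R, G.adjInd d e * (w d e + w e d) := by
      simp only [nbrCount, Finset.mul_sum]
      exact Finset.sum_congr rfl fun d hd => Finset.sum_congr rfl fun e he => (hw d hd e he).symm
    have h3 : ∑ d ∈ R, ∑ e ∈ R, G.adjInd d e * w e d = ∑ d ∈ R, ∑ e ∈ R, G.adjInd d e * w d e := by
      rw [Finset.sum_comm]
      exact Finset.sum_congr rfl fun d _ => Finset.sum_congr rfl fun e _ => by rw [adjInd_comm]
    simp only [mul_add, Finset.sum_add_distrib] at h1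
    omega
  rw [Finset.sum_add_distrib, hsum, ← Finset.sum_add_distrib, mul_comm, ← smul_eq_mul,
    ← Finset.sum_const]
  refine Finset.sum_le_sum fun d hd => ?_
  have ha := h2 d hd
  by_cases h : 2 ≤ G.nbrCount d R
  · have : ∑ e ∈ R, G.adjInd d e * w d e = 0 :=
      Finset.sum_eq_zero fun e _ => by simp [w, h]
    omega
  · by_cases hc : ∃ e ∈ R, G.Adj d e ∧ 2 ≤ G.nbrCount e R
    · obtain ⟨e, he, hde, her⟩ := hc
      have h1 := (hstar e he her d hd hde.symm).1
      have : ∑ e ∈ R, G.adjInd d e * w d e ≤ ∑ e ∈ R, G.adjInd d e * 2 :=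
        Finset.sum_le_sum fun e _ => Nat.mul_le_mul_left _ (by simp only [w]; split_ifs <;> omega)
      rw [← Finset.sum_mul] at this
      change _ ≤ G.nbrCount d R * 2 at this
      omega
    · push Not at hc
      have : ∑ e ∈ R, G.adjInd d e * w d e ≤ ∑ e ∈ R, G.adjInd d e := by
        refine Finset.sum_le_sum fun e he => ?_
        by_cases hde : G.Adj d e
        · have := hc e he hde
          have hw1 : w d e = 1 := by simp only [w]; split_ifs <;> omega
          rw [hw1, mul_one]
        · simp [adjInd_of_not_adj hde]
      change _ ≤ G.nbrCount d R at this
      omega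

/-! ### Chords of a longest cycle of length six -/

lemma sum_nbrCount_hexagon [DecidableEq V] {v₀ v₁ v₂ v₃ v₄ v₅ : V}
    (hn : [v₀, v₁, v₂, v₃, v₄, v₅].Nodup) :
    ∑ u ∈ [v₀, v₁, v₂, v₃, v₄, v₅].toFinset, G.nbrCount u [v₀, v₁, v₂, v₃, v₄, v₅].toFinset ≤
      2 * (6 + G.adjInd v₀ v₂ + G.adjInd v₀ v₃ + G.adjInd v₀ v₄ + G.adjInd v₁ v₃ +
        G.adjInd v₁ v₄ + G.adjInd v₁ v₅ + G.adjInd v₂ v₄ + G.adjInd v₂ v₅ + G.adjInd v₃ v₅) := by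
  simp_rw [nbrCount_toFinset hn]
  rw [List.sum_toFinset _ hn]
  simp only [List.map_cons, List.map_nil, List.sum_cons, List.sum_nil, adjInd_self]
  have h := G.adjInd_comm
  rw [h v₁ v₀, h v₂ v₀, h v₃ v₀, h v₄ v₀, h v₅ v₀, h v₂ v₁, h v₃ v₁, h v₄ v₁, h v₅ v₁, h v₃ v₂,
    h v₄ v₂, h v₅ v₂, h v₄ v₃, h v₅ v₃, h v₅ v₄]
  have := G.adjInd_le_one v₀ v₁
  have := G.adjInd_le_one v₁ v₂
  have := G.adjInd_le_one v₂ v₃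
  have := G.adjInd_le_one v₃ v₄
  have := G.adjInd_le_one v₄ v₅
  have := G.adjInd_le_one v₀ v₅
  omega

section Chords

variable [DecidableEq V] {v₀ v₁ v₂ v₃ v₄ v₅ : V}

lemma IsLongestCycleList.chords_of_long_ear
    (hl : G.IsLongestCycleList [v₀, v₁, v₂, v₃, v₄, v₅]) {p q : V}
    (hp : p ∉ [v₀, v₁, v₂, v₃, v₄, v₅]) (hq : q ∉ [v₀, v₁, v₂, v₃, v₄, v₅]) (hpq : G.Adj p q)
    (h0 : G.Adj v₀ p) (h3 : G.Adj q v₃) :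
    ∑ u ∈ [v₀, v₁, v₂, v₃, v₄, v₅].toFinset, G.nbrCount u [v₀, v₁, v₂, v₃, v₄, v₅].toFinset ≤
      22 := by
  have hn := hl.1.nodup
  obtain ⟨a01, a12, a23, a34, a45, a50⟩ := hl.adj_hexagon
  have hne := hpq.ne
  have key := fun B => hl.false_of_longer (x := v₀) (y := v₃) (A := [p, q]) (B := B)
    (by simp [h0, hpq, h3]) (by simpa using hne)
  have h15 : ¬ G.Adj v₁ v₅ := fun h => key [v₂, v₁, v₅] (by clear key; grind)
    (by clear key; grind) (by simp) (by simp; grind [adj_comm])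
  have h14 : ¬ G.Adj v₁ v₄ := fun h => key [v₂, v₁, v₄, v₅] (by clear key; grind)
    (by clear key; grind) (by simp) (by simp; grind [adj_comm])
  have h25 : ¬ G.Adj v₂ v₅ := fun h => key [v₄, v₅, v₂, v₁] (by clear key; grind)
    (by clear key; grind) (by simp) (by simp; grind [adj_comm])
  have h24 : ¬ G.Adj v₂ v₄ := fun h => key [v₂, v₄, v₅] (by clear key; grind)
    (by clear key; grind) (by simp) (by simp; grind [adj_comm])
  have hs := sum_nbrCount_hexagon (G := G) hn
  rw [adjInd_of_not_adj h15, adjInd_of_not_adj h14, adjInd_of_not_adj h25,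
    adjInd_of_not_adj h24] at hs
  have := G.adjInd_le_one v₀ v₂
  have := G.adjInd_le_one v₀ v₃
  have := G.adjInd_le_one v₀ v₄
  have := G.adjInd_le_one v₁ v₃
  have := G.adjInd_le_one v₃ v₅
  omega

lemma IsLongestCycleList.chords_of_adj_opposite
    (hl : G.IsLongestCycleList [v₀, v₁, v₂, v₃, v₄, v₅]) {d : V}
    (hd : d ∉ [v₀, v₁, v₂, v₃, v₄, v₅]) (h0 : G.Adj d v₀) (h3 : G.Adj d v₃) :
    ∑ u ∈ [v₀, v₁, v₂, v₃, v₄, v₅].toFinset, G.nbrCount u [v₀, v₁, v₂, v₃, v₄, v₅].toFinset ≤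
      24 := by
  have hn := hl.1.nodup
  obtain ⟨a01, a12, a23, a34, a45, a50⟩ := hl.adj_hexagon
  have key := fun B => hl.false_of_longer (x := v₀) (y := v₃) (A := [d]) (B := B)
    (by simp [h0.symm, h3]) (by simp)
  have h14 : ¬ G.Adj v₁ v₄ := fun h => key [v₂, v₁, v₄, v₅] (by clear key; grind)
    (by clear key; grind) (by simp) (by simp; grind [adj_comm])
  have h25 : ¬ G.Adj v₂ v₅ := fun h => key [v₄, v₅, v₂, v₁] (by clear key; grind)
    (by clear key; grind) (by simp) (by simp; grind [adj_comm])
  have h24 : ¬ (G.Adj v₂ v₄ ∧ G.Adj v₁ v₅) := fun h => key [v₄, v₂, v₁, v₅] (by clear key; grind)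
    (by clear key; grind) (by simp) (by simp; grind [adj_comm])
  have hs := sum_nbrCount_hexagon (G := G) hn
  rw [adjInd_of_not_adj h14, adjInd_of_not_adj h25] at hs
  have := adjInd_add_le_one h24
  have := G.adjInd_le_one v₀ v₂
  have := G.adjInd_le_one v₀ v₃
  have := G.adjInd_le_one v₀ v₄
  have := G.adjInd_le_one v₁ v₃
  have := G.adjInd_le_one v₃ v₅
  omega

lemma IsLongestCycleList.chords_of_adj_even
    (hl : G.IsLongestCycleList [v₀, v₁, v₂, v₃, v₄, v₅]) {d : V}
    (hd : d ∉ [v₀, v₁, v₂, v₃, v₄, v₅]) (h0 : G.Adj d v₀) (h2 : G.Adj d v₂) :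
    ∑ u ∈ [v₀, v₁, v₂, v₃, v₄, v₅].toFinset, G.nbrCount u [v₀, v₁, v₂, v₃, v₄, v₅].toFinset ≤
      24 := by
  have hn := hl.1.nodup
  obtain ⟨a01, a12, a23, a34, a45, a50⟩ := hl.adj_hexagon
  have key := fun B => hl.false_of_longer (x := v₀) (y := v₂) (A := [d]) (B := B)
    (by simp [h0.symm, h2]) (by simp)
  have h13 : ¬ G.Adj v₁ v₃ := fun h => key [v₁, v₃, v₄, v₅] (by clear key; grind)
    (by clear key; grind) (by simp) (by simp; grind [adj_comm])
  have h15 : ¬ G.Adj v₁ v₅ := fun h => key [v₃, v₄, v₅, v₁] (by clear key; grind)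
    (by clear key; grind) (by simp) (by simp; grind [adj_comm])
  have h35 : ¬ (G.Adj v₃ v₅ ∧ G.Adj v₁ v₄) := fun h => key [v₁, v₄, v₃, v₅] (by clear key; grind)
    (by clear key; grind) (by simp) (by simp; grind [adj_comm])
  have hs := sum_nbrCount_hexagon (G := G) hn
  rw [adjInd_of_not_adj h13, adjInd_of_not_adj h15] at hs
  have := adjInd_add_le_one h35
  have := G.adjInd_le_one v₀ v₂
  have := G.adjInd_le_one v₀ v₃
  have := G.adjInd_le_one v₀ v₄
  have := G.adjInd_le_one v₂ v₄
  have := G.adjInd_le_one v₂ v₅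
  omega

end Chords

end SimpleGraph

/-! ### The dichotomy between few edges and a small cover -/

namespace SimpleGraph

variable {V : Type*} {G : SimpleGraph V}

/-- The hypothesis of `sum_le_five_mul_card` that concerns stars holds outside of a longest cycle of
length at most `6`. -/
lemma IsVertexConnected.nbrCount_le_one_of_center [Fintype V] [DecidableEq V]
    (hG : G.IsVertexConnected 2)
    {l : List V} (hl : G.IsLongestCycleList l) (hl6 : l.length ≤ 6) {d e : V} (hd : d ∉ l)
    (he : e ∉ l) (hde : G.Adj d e) (h : 2 ≤ G.nbrCount d l.toFinsetᶜ) :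
    G.nbrCount e l.toFinset ≤ 1 ∧ G.nbrCount e l.toFinsetᶜ ≤ 1 := by
  -- The two ends of a path with three or four vertices outside of the cycle have the same
  -- neighbours on the cycle.
  have h3 : ∀ p q r x y, p ∉ l → q ∉ l → r ∉ l → x ∈ l → y ∈ l → p ≠ r → G.Adj p q → G.Adj q r →
      G.Adj p x → G.Adj r y → x = y := by
    intro p q r x y hp hq hr hx hy hpr hpq hqr hpx hry
    by_contra hxy
    have := hl.two_mul_ear_le hx hy hxy (P := [p, q, r])
      (by simp [hpr, hpq.ne, hqr.ne]) (by simp [hp, hq, hr]) (by simp [hpx.symm, hpq, hqr, hry])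
    simp at this
    omega
  have h4 : ∀ p q r s x y, p ∉ l → q ∉ l → r ∉ l → s ∉ l → x ∈ l → y ∈ l → p ≠ r → p ≠ s →
      q ≠ s → G.Adj p q → G.Adj q r → G.Adj r s → G.Adj p x → G.Adj s y → x = y := by
    intro p q r s x y hp hq hr hs hx hy hpr hps hqs hpq hqr hrs hpx hsy
    by_contra hxy
    have := hl.two_mul_ear_le hx hy hxy (P := [p, q, r, s])
      (by simp [hpr, hps, hqs, hpq.ne, hqr.ne, hrs.ne]) (by simp [hp, hq, hr, hs])
      (by simp [hpx.symm, hpq, hqr, hrs, hsy])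
    simp at this
    omega
  obtain ⟨e', he', hde', hee'⟩ : ∃ e', e' ∉ l ∧ G.Adj d e' ∧ e ≠ e' := by
    obtain ⟨v, hv, w, hw, hvw, hdv, hdw⟩ := exists_two_adj_of_nbrCount h
    simp only [Finset.mem_compl, List.mem_toFinset] at hv hw
    by_cases hev : e = v
    · exact ⟨w, hw, hdw, hev ▸ hvw⟩
    · exact ⟨v, hv, hdv, hev⟩
  obtain ⟨z, hz, hez⟩ := hG.exists_adj_mem hl hl6 he
  obtain ⟨z', hz', hez'⟩ := hG.exists_adj_mem hl hl6 he'
  obtain rfl := h3 e d e' z z' he hd he' hz hz' hee' hde.symm hde' hez hez'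
  have heq : ∀ x ∈ l, G.Adj e x → x = z := fun x hx hex =>
    h3 e d e' x z he hd he' hx hz hee' hde.symm hde' hex hez'
  constructor
  · refine nbrCount_le_one fun v hv w hw hev hew => ?_
    simp only [List.mem_toFinset] at hv hw
    rw [heq v hv hev, heq w hw hew]
  · refine nbrCount_le_one fun v hv w hw hev hew => ?_
    simp only [Finset.mem_compl, List.mem_toFinset] at hv hw
    by_contra hvw
    -- So `e` has a neighbour `g` other than `d`; then `z` is the only contact of `d`, `e` and `g`.
    obtain ⟨g, hg, heg, hgd⟩ : ∃ g, g ∉ l ∧ G.Adj e g ∧ g ≠ d := by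
      by_cases hvd : v = d
      · exact ⟨w, hw, hew, hvd ▸ Ne.symm hvw⟩
      · exact ⟨v, hv, hev, hvd⟩
    have hgz : ∀ x ∈ l, G.Adj g x → x = z := by
      intro x hx hgx
      by_cases hge' : g = e'
      · subst hge'
        exact (h3 e d g z x he hd hg hz hx hee' hde.symm hde' hez hgx).symm
      · exact (h4 e' d e g z x he' hd he hg hz hx (Ne.symm hee') (Ne.symm hge') (Ne.symm hgd)
          hde'.symm hde heg hez' hgx).symm
    have hgz' : G.Adj g z := by
      obtain ⟨x, hx, hgx⟩ := hG.exists_adj_mem hl hl6 hg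
      rwa [← hgz x hx hgx]
    have hdz : ∀ x ∈ l, G.Adj d x → x = z := fun x hx hdx =>
      h3 d e g x z hd he hg hx hz (Ne.symm hgd) hde heg hdx hgz'
    obtain ⟨y, hy, hyz, hey | ⟨-, f, hf, hef, hfy⟩⟩ := hG.exists_ear hl hl6 he hz hez
    · exact hyz (heq y hy hey)
    · have hfd : f ≠ d := by
        rintro rfl
        exact hyz (hdz y hy hfy)
      obtain ⟨x, hx, hdx⟩ := hG.exists_adj_mem hl hl6 hd
      have := h3 f e d y x hf he hd hy hx hfd hef.symm hde.symm hfy hdx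
      exact hyz (this.trans (hdz x hx hdx))

/-- An edge outside of a longest cycle of length at most `6` gives rise to an ear with two inner
vertices. -/
lemma IsVertexConnected.exists_long_ear [Fintype V]
    (hG : G.IsVertexConnected 2) {l : List V}
    (hl : G.IsLongestCycleList l) (hl6 : l.length ≤ 6) {d e : V} (hd : d ∉ l) (he : e ∉ l)
    (hde : G.Adj d e) : ∃ p q x y, p ∉ l ∧ q ∉ l ∧ x ∈ l ∧ y ∈ l ∧ x ≠ y ∧ G.Adj p q ∧
      G.Adj x p ∧ G.Adj q y := by
  obtain ⟨x, hx, hdx⟩ := hG.exists_adj_mem hl hl6 hd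
  obtain ⟨z, hz, hez⟩ := hG.exists_adj_mem hl hl6 he
  obtain ⟨y, hy, hyx, hdy | ⟨-, f, hf, hdf, hfy⟩⟩ := hG.exists_ear hl hl6 hd hx hdx
  · by_cases hxz : x = z
    · exact ⟨d, e, y, z, hd, he, hy, hz, hxz ▸ hyx, hde, hdy.symm, hez⟩
    · exact ⟨d, e, x, z, hd, he, hx, hz, hxz, hde, hdx.symm, hez⟩
  · exact ⟨d, f, x, y, hd, hf, hx, hy, hyx.symm, hdf, hdx.symm, hfy⟩

lemma IsLongestCycleList.two_mul_nbrCount_le [DecidableEq V] {l : List V}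
    (hl : G.IsLongestCycleList l) (hl6 : l.length ≤ 6) {d : V} (hd : d ∉ l) :
    2 * G.nbrCount d l.toFinset ≤ l.length := by
  have key : ∀ x y B, l ~r (x :: y :: B) → G.adjInd d x + G.adjInd d y ≤ 1 :=
    fun x y B hr => adjInd_add_le_one fun h =>
      (hl.of_isRotated hr).not_adj_of_consecutive (mt hr.mem_iff.2 hd) h.1 h.2
  rw [nbrCount_toFinset hl.1.nodup]
  have h3 := hl.1.three_le
  match l, h3, hl6 with
  | [a, b, c], _, _ =>
    have := key a b _ ⟨0, rfl⟩
    have := key b c _ ⟨1, rfl⟩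
    have := key c a _ ⟨2, rfl⟩
    simp
    omega
  | [a, b, c, d'], _, _ =>
    have := key a b _ ⟨0, rfl⟩
    have := key c d' _ ⟨2, rfl⟩
    simp
    omega
  | [a, b, c, d', e], _, _ =>
    have := key a b _ ⟨0, rfl⟩
    have := key b c _ ⟨1, rfl⟩
    have := key c d' _ ⟨2, rfl⟩
    have := key d' e _ ⟨3, rfl⟩
    have := key e a _ ⟨4, rfl⟩
    simp
    omega
  | [a, b, c, d', e, f], _, _ =>
    have := key a b _ ⟨0, rfl⟩
    have := key c d' _ ⟨2, rfl⟩
    have := key e f _ ⟨4, rfl⟩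
    simp
    omega

/-- A vertex outside of a longest cycle of length six with three neighbours on it is adjacent to
every other vertex of the cycle. -/
lemma IsLongestCycleList.exists_rotation_of_three_le [DecidableEq V] {l : List V}
    (hl : G.IsLongestCycleList l) (hl6 : l.length = 6) {d : V} (hd : d ∉ l)
    (h : 3 ≤ G.nbrCount d l.toFinset) :
    ∃ v₀ v₁ v₂ v₃ v₄ v₅, l ~r [v₀, v₁, v₂, v₃, v₄, v₅] ∧ G.Adj d v₀ ∧ G.Adj d v₂ ∧ G.Adj d v₄ := by
  have key : ∀ x y B, l ~r (x :: y :: B) → G.adjInd d x + G.adjInd d y ≤ 1 :=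
    fun x y B hr => adjInd_add_le_one fun h =>
      (hl.of_isRotated hr).not_adj_of_consecutive (mt hr.mem_iff.2 hd) h.1 h.2
  rw [nbrCount_toFinset hl.1.nodup] at h
  match l, hl6 with
  | [a, b, c, d', e, f], _ =>
    have := key a b _ ⟨0, rfl⟩
    have := key b c _ ⟨1, rfl⟩
    have := key c d' _ ⟨2, rfl⟩
    have := key d' e _ ⟨3, rfl⟩
    have := key e f _ ⟨4, rfl⟩
    have := key f a _ ⟨5, rfl⟩
    simp at h
    by_cases ha : G.Adj d a
    · have h1 := adjInd_of_adj ha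
      exact ⟨a, b, c, d', e, f, ⟨0, rfl⟩, ha, adjInd_eq_one.1 (by omega), adjInd_eq_one.1 (by omega)⟩
    · have h1 := adjInd_of_not_adj ha
      exact ⟨b, c, d', e, f, a, ⟨1, rfl⟩, adjInd_eq_one.1 (by omega), adjInd_eq_one.1 (by omega),
        adjInd_eq_one.1 (by omega)⟩

lemma sum_nbrCount_congr_of_isRotated [DecidableEq V] {l l' : List V} (h : l ~r l') :
    ∑ u ∈ l.toFinset, G.nbrCount u l.toFinset = ∑ u ∈ l'.toFinset, G.nbrCount u l'.toFinset := by
  rw [List.toFinset_eq_of_perm _ _ h.perm]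

/-- A list of length six can be rotated so that it begins with a given element. -/
lemma exists_rotation_of_mem {l : List V} (hl6 : l.length = 6) {x : V} (hx : x ∈ l) :
    ∃ v₁ v₂ v₃ v₄ v₅, l ~r [x, v₁, v₂, v₃, v₄, v₅] := by
  match l, hl6 with
  | [a, b, c, d, e, f], _ =>
    simp only [List.mem_cons, List.not_mem_nil, or_false] at hx
    rcases hx with rfl | rfl | rfl | rfl | rfl | rfl
    · exact ⟨_, _, _, _, _, 0, rfl⟩
    · exact ⟨_, _, _, _, _, 1, rfl⟩
    · exact ⟨_, _, _, _, _, 2, rfl⟩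
    · exact ⟨_, _, _, _, _, 3, rfl⟩
    · exact ⟨_, _, _, _, _, 4, rfl⟩
    · exact ⟨_, _, _, _, _, 5, rfl⟩

lemma IsLongestCycleList.sum_nbrCount_le_of_long_ear [DecidableEq V] {l : List V}
    (hl : G.IsLongestCycleList l) (hl6 : l.length = 6) {p q x y : V} (hp : p ∉ l) (hq : q ∉ l)
    (hx : x ∈ l) (hy : y ∈ l) (hxy : x ≠ y) (hpq : G.Adj p q) (hxp : G.Adj x p) (hqy : G.Adj q y) :
    ∑ u ∈ l.toFinset, G.nbrCount u l.toFinset ≤ 22 := by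
  obtain ⟨v₁, v₂, v₃, v₄, v₅, hr⟩ := exists_rotation_of_mem hl6 hx
  rw [sum_nbrCount_congr_of_isRotated hr]
  have hl' := hl.of_isRotated hr
  rw [hr.mem_iff] at hp hq hy
  have hn : [p, q].Nodup := by simpa using hpq.ne
  have hc : (x :: ([p, q] ++ [y])).IsChain G.Adj := by simp [hpq, hxp, hqy]
  have hc' : (y :: ([p, q].reverse ++ [x])).IsChain G.Adj := isChain_reverse_link hc
  have hd : ∀ v ∈ [p, q], v ∉ [x, v₁, v₂, v₃, v₄, v₅] := by
    intro v hv
    simp only [List.mem_cons, List.not_mem_nil, or_false] at hv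
    rcases hv with rfl | rfl <;> assumption
  have hr4 : [x, v₁, v₂, v₃, v₄, v₅] ~r [v₄, v₅, x, v₁, v₂, v₃] := ⟨4, rfl⟩
  have hr5 : [x, v₁, v₂, v₃, v₄, v₅] ~r [v₅, x, v₁, v₂, v₃, v₄] := ⟨5, rfl⟩
  have hy' := hy
  simp only [List.mem_cons, List.not_mem_nil, or_false] at hy'
  rcases hy' with rfl | rfl | rfl | rfl | rfl | rfl
  · exact absurd rfl hxy
  · simpa using hl'.length_le_of_ear (A := []) hn hd hc
  · simpa using hl'.length_le_of_ear (A := [v₁]) hn hd hc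
  · exact hl'.chords_of_long_ear hp hq hpq hxp hqy
  · simpa using (hl'.of_isRotated hr4).length_le_of_ear (A := [v₅]) (List.nodup_reverse.2 hn)
      (fun v hv => mt hr4.mem_iff.2 (hd v (List.mem_reverse.1 hv))) hc'
  · simpa using (hl'.of_isRotated hr5).length_le_of_ear (A := []) (List.nodup_reverse.2 hn)
      (fun v hv => mt hr5.mem_iff.2 (hd v (List.mem_reverse.1 hv))) hc'

lemma IsLongestCycleList.sum_nbrCount_le_of_two_adj [DecidableEq V] {l : List V}
    (hl : G.IsLongestCycleList l) (hl6 : l.length = 6) {d x y : V} (hd : d ∉ l)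
    (hx : x ∈ l) (hy : y ∈ l) (hxy : x ≠ y) (hdx : G.Adj d x) (hdy : G.Adj d y) :
    ∑ u ∈ l.toFinset, G.nbrCount u l.toFinset ≤ 24 := by
  obtain ⟨v₁, v₂, v₃, v₄, v₅, hr⟩ := exists_rotation_of_mem hl6 hx
  rw [sum_nbrCount_congr_of_isRotated hr]
  have hl' := hl.of_isRotated hr
  rw [hr.mem_iff] at hd hy
  have hr4 : [x, v₁, v₂, v₃, v₄, v₅] ~r [v₄, v₅, x, v₁, v₂, v₃] := ⟨4, rfl⟩
  have hr5 : [x, v₁, v₂, v₃, v₄, v₅] ~r [v₅, x, v₁, v₂, v₃, v₄] := ⟨5, rfl⟩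
  simp only [List.mem_cons, List.not_mem_nil, or_false] at hy
  rcases hy with rfl | rfl | rfl | rfl | rfl | rfl
  · exact absurd rfl hxy
  · exact absurd hdy (hl'.not_adj_of_consecutive hd hdx)
  · exact hl'.chords_of_adj_even hd hdx hdy
  · exact hl'.chords_of_adj_opposite hd hdx hdy
  · rw [sum_nbrCount_congr_of_isRotated hr4]
    exact (hl'.of_isRotated hr4).chords_of_adj_even (mt hr4.mem_iff.2 hd) hdy hdx
  · exact absurd hdx
      ((hl'.of_isRotated hr5).not_adj_of_consecutive (mt hr5.mem_iff.2 hd) hdy)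

lemma IsVertexConnected.exists_isLongestCycleList [Fintype V]
    (hG : G.IsVertexConnected 2)
    (hc : G.CircumferenceLT 7) : ∃ l, G.IsLongestCycleList l ∧ l.length ≤ 6 := by
  classical
  have hle : ∀ l, G.IsCycleList l → l.length ≤ 6 := by
    intro l hl
    obtain ⟨v, p, hp, hlen⟩ := hl.exists_isCycle
    have := hc v p hp
    omega
  obtain ⟨l₀, hl₀⟩ := hG.exists_isCycleList
  obtain ⟨l, hl, hlen⟩ := Nat.findGreatest_spec (P := fun k => ∃ l, G.IsCycleList l ∧ l.length = k)
    (hle l₀ hl₀) ⟨l₀, hl₀, rfl⟩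
  exact ⟨l, ⟨hl, fun l' hl' => hlen ▸ Nat.le_findGreatest (hle l' hl') ⟨l', hl', rfl⟩⟩, hle l hl⟩

/-- A `2`-connected graph of circumference at most `6` has a vertex cover of size `3`, or at most
`(5 n - 8) / 2` edges. -/
theorem IsVertexConnected.exists_cover_or_ncard_edgeSet_le [Fintype V]
    (hG : G.IsVertexConnected 2)
    (hc : G.CircumferenceLT 7) (hn : 8 ≤ Fintype.card V) :
    (∃ A : Finset V, A.card = 3 ∧ ∀ u w, G.Adj u w → u ∈ A ∨ w ∈ A) ∨
      2 * G.edgeSet.ncard + 8 ≤ 5 * Fintype.card V := by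
  classical
  obtain ⟨l, hl, hl6⟩ := hG.exists_isLongestCycleList hc
  have h3 := hl.1.three_le
  have hcard : l.toFinset.card = l.length := List.toFinset_card_of_nodup hl.1.nodup
  have hcardc : l.length + (l.toFinset)ᶜ.card = Fintype.card V := by
    rw [← hcard, Finset.card_add_card_compl]
  have hR : ∀ d, d ∈ (l.toFinset)ᶜ ↔ d ∉ l := by simp
  have hcount := two_mul_ncard_edgeSet (G := G) l.toFinset
  by_cases hthree : ∃ d, d ∉ l ∧ 3 ≤ G.nbrCount d l.toFinset
  · obtain ⟨d, hd, hd3⟩ := hthree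
    have hle := hl.two_mul_nbrCount_le hl6 hd
    obtain ⟨v₀, v₁, v₂, v₃, v₄, v₅, hr, h0, h2, h4⟩ :=
      hl.exists_rotation_of_three_le (by omega) hd hd3
    have hl' := hl.of_isRotated hr
    refine Or.inl ⟨[v₀, v₂, v₄].toFinset, ?_, fun u w huw => ?_⟩
    · have := hl'.1.nodup
      exact List.toFinset_card_of_nodup (l := [v₀, v₂, v₄]) (by grind)
    · simpa only [List.mem_toFinset] using
        hG.cover_of_three_adj hl' (mt hr.mem_iff.2 hd) h0 h2 h4 huw
  right
  push Not at hthree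
  have h2 : ∀ d ∈ (l.toFinset)ᶜ, G.nbrCount d l.toFinset ≤ 2 := fun d hd => by
    have := hthree d ((hR d).1 hd)
    omega
  by_cases hedge : ∃ d e, d ∉ l ∧ e ∉ l ∧ G.Adj d e
  · obtain ⟨d, e, hd, he, hde⟩ := hedge
    obtain ⟨p, q, x, y, hp, hq, hx, hy, hxy, hpq, hxp, hqy⟩ := hG.exists_long_ear hl hl6 hd he hde
    have hlen := hl.two_mul_ear_le hx hy hxy (P := [p, q]) (by simpa using hpq.ne)
      (by simp [hp, hq]) (by simp [hpq, hxp, hqy])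
    have h6 : l.length = 6 := by simp at hlen; omega
    have hC := hl.sum_nbrCount_le_of_long_ear h6 hp hq hx hy hxy hpq hxp hqy
    have hD := sum_le_five_mul_card h2 fun d hd hd2 e he hde =>
      hG.nbrCount_le_one_of_center hl hl6 ((hR d).1 hd) ((hR e).1 he) hde hd2
    omega
  · push Not at hedge
    have hD : ∑ d ∈ (l.toFinset)ᶜ, (2 * G.nbrCount d l.toFinset + G.nbrCount d (l.toFinset)ᶜ) ≤
        (l.toFinset)ᶜ.card * 4 := by
      rw [← smul_eq_mul, ← Finset.sum_const]
      refine Finset.sum_le_sum fun d hd => ?_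
      have h0 : G.nbrCount d (l.toFinset)ᶜ = 0 := nbrCount_eq_zero fun e he =>
        hedge d e ((hR d).1 hd) ((hR e).1 he)
      have := h2 d hd
      omega
    have hC : ∑ u ∈ l.toFinset, G.nbrCount u l.toFinset ≤ l.length * 4 := by
      by_cases h6 : l.length = 6
      · obtain ⟨d, hd⟩ : (l.toFinset)ᶜ.Nonempty := Finset.card_pos.1 (by omega)
        rw [hR] at hd
        obtain ⟨x, hx, hdx⟩ := hG.exists_adj_mem hl hl6 hd
        obtain ⟨y, hy, hyx, hdy | ⟨-, f, hf, hdf, -⟩⟩ := hG.exists_ear hl hl6 hd hx hdx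
        · rw [h6]
          exact hl.sum_nbrCount_le_of_two_adj h6 hd hx hy hyx.symm hdx hdy
        · exact absurd hdf (hedge d f hd hf)
      · rw [← hcard, ← smul_eq_mul, ← Finset.sum_const]
        refine Finset.sum_le_sum fun u hu => ?_
        have := nbrCount_lt_card (G := G) hu
        omega
    omega

end SimpleGraph

/-! ### Covers of size three and subgraphs of the Kopylov graph -/

namespace SimpleGraph

lemma kopylovGraph_adj {n : ℕ} {i j : Fin n} :
    (kopylovGraph n 7 3).Adj i j ↔ i ≠ j ∧ ((i : ℕ) < 3 ∨ (j : ℕ) < 3) := by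
  simp only [kopylovGraph, ne_eq, Fin.ext_iff]
  omega

lemma isContained_kopylovGraph {V : Type*} [Fintype V] {G : SimpleGraph V} {n : ℕ} (hn : 3 ≤ n)
    (hV : Fintype.card V = n) {A : Finset V} (hA : A.card = 3)
    (hcover : ∀ u w, G.Adj u w → u ∈ A ∨ w ∈ A) : G.IsContained (kopylovGraph n 7 3) := by
  classical
  let e₀ : V ≃ Fin n := Fintype.equivFinOfCardEq hV
  have hcard : Fintype.card {i : Fin n // i ∈ A.map e₀.toEmbedding} =
      Fintype.card {i : Fin n // (i : ℕ) < 3} := by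
    have h1 : Fintype.card {i : Fin n // (i : ℕ) < 3} = 3 := by
      rw [Fintype.card_subtype, Fin.card_filter_val_lt, min_eq_right hn]
    rw [h1, Fintype.card_coe, Finset.card_map, hA]
  let σ := (Fintype.equivOfCardEq hcard).extendSubtype
  have hσ : ∀ v ∈ A, (σ (e₀ v) : ℕ) < 3 := fun v hv =>
    (Fintype.equivOfCardEq hcard).extendSubtype_mem _ (by simpa using hv)
  refine ⟨⟨⟨fun v => σ (e₀ v), fun {u w} huw => ?_⟩, fun u w h => by simpa using h⟩⟩
  rw [kopylovGraph_adj]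
  refine ⟨by simpa using huw.ne, ?_⟩
  rcases hcover u w huw with h | h
  · exact Or.inl (hσ u h)
  · exact Or.inr (hσ w h)

/-! ### The join of an edge and a matching -/

/-- The join of the edge `{0, 1}` and of the matching `{2, 3}, {4, 5}, …` (which leaves out the
last vertex if `n` is odd). -/
def edgeJoinMatching (n : ℕ) : SimpleGraph (Fin n) where
  Adj i j := i ≠ j ∧ ((i : ℕ) < 2 ∨ (j : ℕ) < 2 ∨ (i : ℕ) / 2 = (j : ℕ) / 2)
  symm := ⟨fun _ _ h => ⟨h.1.symm, by omega⟩⟩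
  loopless := ⟨fun _ h => h.1 rfl⟩

lemma edgeJoinMatching_adj {n : ℕ} {i j : Fin n} : (edgeJoinMatching n).Adj i j ↔
    i ≠ j ∧ ((i : ℕ) < 2 ∨ (j : ℕ) < 2 ∨ (i : ℕ) / 2 = (j : ℕ) / 2) := Iff.rfl

lemma isVertexConnected_edgeJoinMatching {n : ℕ} (hn : 3 ≤ n) :
    (edgeJoinMatching n).IsVertexConnected 2 := by
  refine ⟨by simp; omega, fun S hS => ?_⟩
  obtain ⟨h, hh, hhS⟩ : ∃ h : Fin n, (h : ℕ) < 2 ∧ h ∉ S := by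
    by_contra! hcon
    have h0 := hcon ⟨0, by omega⟩ (by simp)
    have h1 := hcon ⟨1, by omega⟩ (by simp)
    have : 1 < S.card := Finset.one_lt_card.2 ⟨_, h0, _, h1, by simp⟩
    omega
  have hreach : ∀ v : ((S : Set (Fin n))ᶜ : Set (Fin n)),
      ((edgeJoinMatching n).induce ((S : Set (Fin n))ᶜ)).Reachable v ⟨h, by simpa using hhS⟩ := by
    intro v
    by_cases hv : v.1 = h
    · have : v = ⟨h, by simpa using hhS⟩ := Subtype.ext hv
      rw [this]
    · exact Adj.reachable (show (edgeJoinMatching n).Adj v.1 h from ⟨hv, by omega⟩)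
  exact (connected_iff _).2
    ⟨fun u v => (hreach u).trans (hreach v).symm, ⟨⟨h, by simpa using hhS⟩⟩⟩

/-- Three consecutive vertices of a path are not all in the matching, so a cycle of length at least
`7` would pass through `0` or `1` more than once. -/
lemma circumferenceLT_edgeJoinMatching (n : ℕ) : (edgeJoinMatching n).CircumferenceLT 7 := by
  intro v p hp
  by_contra! hlen
  -- The cycle may start in `0`, provided that it contains this vertex.
  obtain ⟨u, q, hq, hqlen, hu⟩ : ∃ (u : Fin n) (q : (edgeJoinMatching n).Walk u u), q.IsCycle ∧
      7 ≤ q.length ∧ ∀ x ∈ q.support, (x : ℕ) = 0 → x = u := by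
    by_cases h : ∃ x ∈ p.support, (x : ℕ) = 0
    · obtain ⟨x, hx, hx0⟩ := h
      refine ⟨x, p.rotate x hx, hp.rotate hx, by simpa using hlen, fun y _ hy0 => ?_⟩
      exact Fin.ext (hy0.trans hx0.symm)
    · push Not at h
      exact ⟨v, p, hp, hlen, fun x hx hx0 => absurd hx0 (h x hx)⟩
  have hinj : ∀ i j, 1 ≤ i → i ≤ q.length → 1 ≤ j → j ≤ q.length →
      (q.getVert i : ℕ) = q.getVert j → i = j := fun i j h1 h2 h3 h4 h =>
    hq.getVert_injOn ⟨h1, h2⟩ ⟨h3, h4⟩ (Fin.ext h)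
  have hne0 : ∀ i, 1 ≤ i → i ≤ 6 → (q.getVert i : ℕ) ≠ 0 := by
    intro i h1 h2 h0
    have h := hu _ (q.getVert_mem_support i) h0
    have := hinj i q.length h1 (by omega) (by omega) le_rfl (by rw [q.getVert_length, h])
    omega
  have hadj : ∀ i, i < 6 → ((q.getVert i : ℕ) < 2 ∨ (q.getVert (i + 1) : ℕ) < 2 ∨
      (q.getVert i : ℕ) / 2 = (q.getVert (i + 1) : ℕ) / 2) := fun i hi =>
    (edgeJoinMatching_adj.1 (q.adj_getVert_succ (by omega : i < q.length))).2
  have hone : ∀ i, 1 ≤ i → i ≤ 4 → (q.getVert i : ℕ) = 1 ∨ (q.getVert (i + 1) : ℕ) = 1 ∨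
      (q.getVert (i + 2) : ℕ) = 1 := by
    intro i h1 h4
    have a1 := hadj i (by omega)
    have a2 := hadj (i + 1) (by omega)
    have n0 := hne0 i h1 (by omega)
    have n1 := hne0 (i + 1) (by omega) (by omega)
    have n2 := hne0 (i + 2) (by omega) (by omega)
    have i01 := mt (hinj i (i + 1) h1 (by omega) (by omega) (by omega)) (by omega)
    have i02 := mt (hinj i (i + 2) h1 (by omega) (by omega) (by omega)) (by omega)
    have i12 := mt (hinj (i + 1) (i + 2) (by omega) (by omega) (by omega) (by omega)) (by omega)
    rw [add_assoc] at a2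
    norm_num at a2
    omega
  have hone' : ∀ i j, 1 ≤ i → i < j → j ≤ 6 → (q.getVert i : ℕ) = 1 → (q.getVert j : ℕ) ≠ 1 := by
    intro i j h1 hij h6 hi hj
    have := hinj i j h1 (by omega) (by omega) (by omega) (by omega)
    omega
  rcases hone 1 le_rfl (by omega) with h | h | h <;>
    rcases hone 4 (by omega) le_rfl with h' | h' | h' <;>
    exact hone' _ _ (by omega) (by omega) (by omega) h h'

open Finset in
lemma ncard_edgeSet_edgeJoinMatching {n : ℕ} (hn : 2 ≤ n) :
    (edgeJoinMatching n).edgeSet.ncard = (5 * n - 6) / 2 - 1 := by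
  classical
  let f : ℕ → ℕ → ℕ := fun i j => if i ≠ j ∧ (i < 2 ∨ j < 2 ∨ i / 2 = j / 2) then 1 else 0
  have hcomm : ∀ i j, f i j = f j i := fun i j => by simp only [f]; congr 1; apply propext; omega
  have h1 : 2 * (edgeJoinMatching n).edgeSet.ncard = ∑ i ∈ range n, ∑ j ∈ range n, f i j := by
    have := two_mul_ncard_edgeSet (G := edgeJoinMatching n) univ
    simp only [compl_univ, sum_empty, add_zero] at this
    rw [this, sum_range]
    refine sum_congr rfl fun i _ => ?_
    rw [sum_range]
    refine sum_congr rfl fun j _ => ?_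
    simp [f, adjInd, edgeJoinMatching_adj, Fin.ext_iff]
  -- The vertex `m ≥ 2` has two or three smaller neighbours, according to its parity.
  have hrow : ∀ m, 2 ≤ m → ∑ i ∈ range m, f i m = 2 + m % 2 := by
    intro m hm
    have hf : (range m).filter (fun i => i ≠ m ∧ (i < 2 ∨ m < 2 ∨ i / 2 = m / 2)) =
        range 2 ∪ (range m).filter (fun i => i = m - 1 ∧ 1 ≤ m % 2) := by
      ext i
      simp only [mem_filter, mem_range, mem_union]
      omega
    have hcard : ((range m).filter (fun i => i = m - 1 ∧ 1 ≤ m % 2)).card = m % 2 := by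
      rcases Nat.mod_two_eq_zero_or_one m with h | h
      · simp [h]
      · have : (range m).filter (fun i => i = m - 1 ∧ 1 ≤ m % 2) = {m - 1} := by
          ext i
          simp only [mem_filter, mem_range, mem_singleton]
          omega
        rw [this, h, card_singleton]
    rw [sum_boole, hf, Nat.cast_id, card_union_of_disjoint, hcard, card_range]
    rw [Finset.disjoint_left]
    simp only [mem_filter, mem_range]
    omega
  have h2 : ∀ m, 2 ≤ m → ∑ i ∈ range m, ∑ j ∈ range m, f i j + 8 + m % 2 = 5 * m := by
    intro m hm
    induction m, hm using Nat.le_induction with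
    | base => simp only [f]; decide
    | succ m hm ih =>
      have hself : f m m = 0 := by simp [f]
      have hrow' : ∑ j ∈ range m, f m j = 2 + m % 2 := by
        rw [← hrow m hm]
        exact sum_congr rfl fun j _ => hcomm m j
      simp only [sum_range_succ, sum_add_distrib]
      rw [hrow m hm, hrow', hself]
      omega
  have := h2 n hn
  omega

lemma not_isContained_kopylovGraph_edgeJoinMatching {n : ℕ} (hn : 8 ≤ n) :
    ¬ (edgeJoinMatching n).IsContained (kopylovGraph n 7 3) := by
  rintro ⟨f⟩
  -- The four disjoint edges `{2 k, 2 k + 1}` cannot be covered by three vertices.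
  have hedge : ∀ k, (hk : 2 * k + 1 < n) →
      (f ⟨2 * k, by omega⟩ : ℕ) < 3 ∨ (f ⟨2 * k + 1, hk⟩ : ℕ) < 3 := by
    intro k hk
    have : (edgeJoinMatching n).Adj ⟨2 * k, by omega⟩ ⟨2 * k + 1, hk⟩ :=
      ⟨by simp, by simp only; omega⟩
    exact (kopylovGraph_adj.1 (f.toHom.map_adj this)).2
  have hinj : ∀ i j, (hi : i < n) → (hj : j < n) → i ≠ j → (f ⟨i, hi⟩ : ℕ) ≠ f ⟨j, hj⟩ := by
    intro i j hi hj hij h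
    have := f.injective (Fin.ext h)
    simp only [Fin.mk.injEq] at this
    exact hij this
  have hchoice : ∀ k, (hk : 2 * k + 1 < n) → ∃ i, ∃ hi : i < n, i / 2 = k ∧ (f ⟨i, hi⟩ : ℕ) < 3 := by
    intro k hk
    rcases hedge k hk with h | h
    · exact ⟨2 * k, by omega, by omega, h⟩
    · exact ⟨2 * k + 1, hk, by omega, h⟩
  obtain ⟨a, ha, hak, haf⟩ := hchoice 0 (by omega)
  obtain ⟨b, hb, hbk, hbf⟩ := hchoice 1 (by omega)
  obtain ⟨c, hc, hck, hcf⟩ := hchoice 2 (by omega)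
  obtain ⟨d, hd, hdk, hdf⟩ := hchoice 3 (by omega)
  have := hinj a b ha hb (by omega)
  have := hinj a c ha hc (by omega)
  have := hinj a d ha hd (by omega)
  have := hinj b c hb hc (by omega)
  have := hinj b d hb hd (by omega)
  have := hinj c d hc hd (by omega)
  omega

end SimpleGraph

theorem corollary12 (n : ℕ) (hn : 8 ≤ n) :
    (∀ (V : Type*) [Fintype V] (G : SimpleGraph V), Fintype.card V = n →
      G.IsVertexConnected 2 → G.CircumferenceLT 7 → (5 * n - 6) / 2 ≤ G.edgeSet.ncard →
        G.IsContained (kopylovGraph n 7 3)) ∧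
    (∃ G : SimpleGraph (Fin n),
      G.IsVertexConnected 2 ∧ G.CircumferenceLT 7 ∧ G.edgeSet.ncard = (5 * n - 6) / 2 - 1 ∧
        ¬ G.IsContained (kopylovGraph n 7 3)) := by
  refine ⟨fun V _ G hV hG hc he => ?_, .edgeJoinMatching n,
    SimpleGraph.isVertexConnected_edgeJoinMatching (by omega),
    SimpleGraph.circumferenceLT_edgeJoinMatching n,
    SimpleGraph.ncard_edgeSet_edgeJoinMatching (by omega),
    SimpleGraph.not_isContained_kopylovGraph_edgeJoinMatching hn⟩
  obtain ⟨A, hA, hcover⟩ | hfew := hG.exists_cover_or_ncard_edgeSet_le hc (by omega)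
  · exact SimpleGraph.isContained_kopylovGraph (by omega) hV hA hcover
  · omega
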